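/- Let $k$ be an algebraically closed field of characteristic $p>0$, let $V$ be a finite-dimensional $k$-vector space, and let $G\subset GL(V)$ be a finite subgroup whose order $\#G$ is not divisible by $p$. Let $S=S^{\bullet}V$ be the symmetric algebra of $V$ with the natural $G$-action, let $R=S^{G}$ be the ring of invariants, and let $\mathfrak m=S^{>0}V\subset S$ be the homogeneous maximal ideal. For $q=p^{e}$ with $e\in\mathbb Z_{\ge 0}$, put $S^{q}=\{f^{q}\mid f\in S\}$ and $R^{q}=\{f^{q}\mid f\in R\}$, and let $\mathfrak m^{[q]}$ be the ideal of $S$ generated by all $f^{q}$, $f\in\mathfrak m$. For a representation $U$ of $G$ over $k$ let $R^{q}(U)=(S^{q}\otimes_{k}U)^{G}$, an $R^{q}$-module; it is called a module of covariants over $R^{q}$ when $U$ is finite-dimensional. An $R^{q}$-module is called a full module of covariants over $R^{q}$ if it is isomorphic to $R^{q}(U)$ for some finite-dimensional representation $U$ of $G$ and contains $R^{q}(U_{i})$ as a direct summand for every irreducible representation $U_{i}$ of $G$. Then: (1) For all sufficiently large $q=p^{e}$ (depending on $k$, $V$ and $G$), the quotient $G$-representation $S/\mathfrak m^{[q]}$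 contains every irreducible representation of $G$ as a direct summand, and $R$ is a full module of covariants over $R^{q}$. (2) If $G$ is abelian, both assertions of (1) hold for every $q=p^{e}\ge \#G$. (3) More precisely, for every $q=p^{e}$ such that $S/\mathfrak m^{[q]}$ contains every irreducible representation of $G$ as a direct summand, $R$ is a full module of covariants over $R^{q}$. -/

import Mathlib

open scoped TensorProduct

noncomputable section

namespace FrobCov

universe u v w

section Summands

/-- The `R`-module `M` is (isomorphic to) a direct summand of the `R`-module `N`. -/
def IsDirectSummand (R : Type*) [CommRing R] (M N : Type*) [AddCommMonoid M] [AddCommMonoid N]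
    [Module R M] [Module R N] : Prop :=
  ∃ (i : M →ₗ[R] N) (r : N →ₗ[R] M), r ∘ₗ i = LinearMap.id

/-- The representation `σ` is (isomorphic to) a direct summand of the representation `τ`. -/
def IsDirectSummandRep {k G U W : Type*} [Field k] [Group G] [AddCommGroup U] [Module k U]
    [AddCommGroup W] [Module k W] (σ : Representation k G U) (τ : Representation k G W) : Prop :=
  ∃ (i : σ.IntertwiningMap τ) (r : τ.IntertwiningMap σ), ∀ x, r (i x) = x

end Summands

/-! Invariants, `q`-th powers and modules of covariants, for a group `G` acting on a commutative
`k`-algebra `A` by algebra endomorphisms. -/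

section General

variable {k : Type u} [Field k] {A : Type v} [CommRing A] [Algebra k A]
  {G : Type w} [Group G] (σ : G →* (A →ₐ[k] A))

/-- An action of `G` on `A` by algebra endomorphisms, as a linear representation. -/
def linRep : Representation k G A where
  toFun g := (σ g).toLinearMap
  map_one' := by rw [map_one]; rfl
  map_mul' g h := by rw [map_mul]; rfl

/-- The ring of invariants `A ^ G`. -/
def invariantRing : Subalgebra k A where
  carrier := {a | ∀ g, σ g a = a}
  mul_mem' ha hb g := by rw [map_mul, ha g, hb g]
  add_mem' ha hb g := by rw [map_add, ha g, hb g]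
  algebraMap_mem' c g := AlgHom.commutes _ c

variable (p : ℕ) [Fact p.Prime] [CharP k p] [PerfectRing k p]

/-- The `k`-subalgebra `B ^ q = {f ^ q | f ∈ B}`, `q = p ^ e`, for a `k`-subalgebra `B` of `A` over
a perfect field `k` of characteristic `p`. -/
def powSubalgebra (B : Subalgebra k A) (e : ℕ) : Subalgebra k A where
  carrier := {x | ∃ f ∈ B, f ^ p ^ e = x}
  mul_mem' := by
    rintro _ _ ⟨f, hf, rfl⟩ ⟨g, hg, rfl⟩
    exact ⟨f * g, B.mul_mem hf hg, mul_pow f g _⟩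
  add_mem' := by
    rintro _ _ ⟨f, hf, rfl⟩ ⟨g, hg, rfl⟩
    refine ⟨f + g, B.add_mem hf hg, ?_⟩
    rcases subsingleton_or_nontrivial A with h | h
    · exact Subsingleton.elim _ _
    have : ExpChar A p := expChar_of_injective_algebraMap (algebraMap k A).injective p
    exact add_pow_expChar_pow f g p e
  algebraMap_mem' := by
    intro c
    obtain ⟨b, hb⟩ := (iterateFrobeniusEquiv k p e).surjective c
    refine ⟨algebraMap k A b, B.algebraMap_mem b, ?_⟩
    rw [← map_pow, ← hb, iterateFrobeniusEquiv_def]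

variable (e : ℕ)

/-- The ring `(A ^ G) ^ q`, `q = p ^ e`. -/
abbrev Rq : Subalgebra k A := powSubalgebra p (invariantRing σ) e

/-- `A ^ G` as a module over its subring `(A ^ G) ^ q`. -/
def RMod : Submodule (Rq σ p e) A where
  carrier := invariantRing σ
  zero_mem' := (invariantRing σ).zero_mem
  add_mem' := (invariantRing σ).add_mem
  smul_mem' := by
    rintro ⟨_, f, hf, rfl⟩ x hx
    exact (invariantRing σ).mul_mem ((invariantRing σ).pow_mem hf _) hx

/-- `A ^ q = {f ^ q | f ∈ A}` as a module over its subring `(A ^ G) ^ q`. -/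
def SqMod : Submodule (Rq σ p e) A where
  carrier := powSubalgebra p (⊤ : Subalgebra k A) e
  zero_mem' := (powSubalgebra p (⊤ : Subalgebra k A) e).zero_mem
  add_mem' := (powSubalgebra p (⊤ : Subalgebra k A) e).add_mem
  smul_mem' := by
    rintro ⟨_, f, hf, rfl⟩ x hx
    exact (powSubalgebra p (⊤ : Subalgebra k A) e).mul_mem ⟨f, trivial, rfl⟩ hx

/-- The action of `g ∈ G` on `A ^ q`, the restriction of its action on `A`. It is linear over
`(A ^ G) ^ q`. -/
def SqMap (g : G) : SqMod σ p e →ₗ[Rq σ p e] SqMod σ p e where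
  toFun x := ⟨σ g x, by
    obtain ⟨_, f, -, rfl⟩ := x
    exact ⟨σ g f, trivial, (map_pow _ _ _).symm⟩⟩
  map_add' x y := Subtype.ext (map_add (σ g) x.1 y.1)
  map_smul' := by
    rintro ⟨_, f, hf, rfl⟩ x
    apply Subtype.ext
    change σ g (f ^ p ^ e * x.1) = f ^ p ^ e * σ g x.1
    rw [map_mul, map_pow, hf g]

/-- The representation of `G` on `A ^ q`. -/
def SqRep : Representation k G (SqMod σ p e) where
  toFun g := (SqMap σ p e g).restrictScalars k
  map_one' := LinearMap.ext fun x => Subtype.ext (by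
    change σ 1 x.1 = x.1
    rw [map_one, AlgHom.one_apply])
  map_mul' g h := LinearMap.ext fun x => Subtype.ext (by
    change σ (g * h) x.1 = σ g (σ h x.1)
    rw [map_mul, AlgHom.mul_apply])

/-- The module of covariants `(A ^ q ⊗ U) ^ G` over `(A ^ G) ^ q`: the elements of `A ^ q ⊗ U` that
are invariant under the diagonal action of `G`. -/
def covariants {U : Type u} [AddCommGroup U] [Module k U] (ρ : Representation k G U) :
    Submodule (Rq σ p e) (SqMod σ p e ⊗[k] U) where
  carrier := {x | ∀ g : G, (SqRep σ p e).tprod ρ g x = x}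
  zero_mem' g := map_zero _
  add_mem' ha hb g := by rw [map_add, ha g, hb g]
  smul_mem' r x hx g := by
    have h : (SqRep σ p e).tprod ρ g x =
      TensorProduct.AlgebraTensorModule.map (SqMap σ p e g) (ρ g) x := rfl
    change TensorProduct.AlgebraTensorModule.map (SqMap σ p e g) (ρ g) (r • x) = r • x
    rw [map_smul, ← h, hx g]

/-- An `(A ^ G) ^ q`-module `M` is a full module of covariants if it is isomorphic to the module of
covariants of some finite-dimensional representation `U` of `G`, and the module of covariants of
every irreducible representation `W` of `G` is a direct summand of `M`. (`G` will be finite;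
irreducible representations are then finite-dimensional, and so have isomorphic copies in the
universe of `k`.) -/
structure IsFullModuleOfCovariants (M : Type*) [AddCommGroup M] [Module (Rq σ p e) M] : Prop where
  isCovariants : ∃ (U : Type u) (_ : AddCommGroup U) (_ : Module k U) (_ : FiniteDimensional k U)
    (ρ : Representation k G U), Nonempty (M ≃ₗ[Rq σ p e] covariants σ p e ρ)
  isFull : ∀ (W : Type u) [AddCommGroup W] [Module k W] (ρ : Representation k G W),
    ρ.IsIrreducible → IsDirectSummand (Rq σ p e) (covariants σ p e ρ) M

end General

section Setting

variable {k : Type u} [Field k] {V : Type v} [AddCommGroup V] [Module k V]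

/-- The natural action of a subgroup `G` of `GL(V)` on the symmetric algebra `S = Sym V`. -/
def symAction (G : Subgroup (LinearMap.GeneralLinearGroup k V)) :
    G →* (SymmetricAlgebra k V →ₐ[k] SymmetricAlgebra k V) where
  toFun g := SymmetricAlgebra.lift
    (SymmetricAlgebra.ι k V ∘ₗ ((g : LinearMap.GeneralLinearGroup k V) : V →ₗ[k] V))
  map_one' := by
    apply SymmetricAlgebra.algHom_ext
    ext x
    simp
  map_mul' g h := by
    apply SymmetricAlgebra.algHom_ext
    ext x
    simp

variable (k V) in
/-- The homogeneous maximal ideal `𝔪 = S^{>0} V` of `S = Sym V`, the ideal generated by `V`. -/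
def maxIdeal : Ideal (SymmetricAlgebra k V) :=
  Ideal.span (Set.range (SymmetricAlgebra.ι k V))

variable (k V) in
/-- The ideal `𝔪^{[q]}` of `S` generated by all `f ^ q` with `f ∈ 𝔪`. -/
def frobPower (q : ℕ) : Ideal (SymmetricAlgebra k V) :=
  Ideal.span {x | ∃ f ∈ maxIdeal k V, f ^ q = x}

variable (G : Subgroup (LinearMap.GeneralLinearGroup k V))

theorem symAction_mem_maxIdeal (g : G) {x : SymmetricAlgebra k V} (hx : x ∈ maxIdeal k V) :
    symAction G g x ∈ maxIdeal k V := by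
  suffices h : maxIdeal k V ≤ (maxIdeal k V).comap (symAction G g) from h hx
  refine Ideal.span_le.2 ?_
  rintro _ ⟨w, rfl⟩
  refine Ideal.subset_span ⟨((g : LinearMap.GeneralLinearGroup k V) : V →ₗ[k] V) w, ?_⟩
  simp [symAction]

theorem symAction_mem_frobPower (q : ℕ) (g : G) {x : SymmetricAlgebra k V}
    (hx : x ∈ frobPower k V q) : symAction G g x ∈ frobPower k V q := by
  suffices h : frobPower k V q ≤ (frobPower k V q).comap (symAction G g) from h hx
  refine Ideal.span_le.2 ?_
  rintro _ ⟨f, hf, rfl⟩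
  exact Ideal.subset_span ⟨symAction G g f, symAction_mem_maxIdeal G g hf, (map_pow _ _ _).symm⟩

/-- The quotient representation of `G` on `S / 𝔪^{[q]}`. -/
def frobQuotRep (q : ℕ) : Representation k G
    (SymmetricAlgebra k V ⧸ (frobPower k V q).restrictScalars k) :=
  (linRep (symAction G)).quotient ((frobPower k V q).restrictScalars k)
    (fun g _ hx => symAction_mem_frobPower G q g hx)

/-- Every irreducible representation of `G` over `k` is a direct summand of `S / 𝔪^{[q]}`. -/
def ContainsAllIrreducibles (q : ℕ) : Prop :=
  ∀ (W : Type u) [AddCommGroup W] [Module k W] (ρ : Representation k G W),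
    ρ.IsIrreducible → IsDirectSummandRep ρ (frobQuotRep G q)

/-- For `R = S ^ G`, `S = Sym V`, and `q = p ^ e`: the `R ^ q`-module `R` is a full module of
covariants over `R ^ q`. -/
def InvariantsFull (p : ℕ) [Fact p.Prime] [CharP k p] [PerfectRing k p] (e : ℕ) : Prop :=
  IsFullModuleOfCovariants (symAction G) p e (RMod (symAction G) p e)

end Setting

end FrobCov

end

/-! Two independent arguments are combined.

Fullness. Since `#G` is prime to `p`, averaging over `G` turns the lift of `S/𝔪^[q]` to `S` by
reduced monomials (all exponents `< q`) into an equivariant section. Reduced monomials form a basis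
of `S` over `S^q`; the averaged lifts agree with them modulo `𝔪^[q]` without exceeding their
degrees, so they form a basis too (`sum_pow_mul_bijective`). Hence multiplication `S^q ⊗ S/𝔪^[q] →
S` is an equivariant bijection, and taking invariants gives `R ≅ R^q(S/𝔪^[q])`. A direct summand of
`S/𝔪^[q]` yields a direct summand of covariants, which proves (3).

Irreducibles, for `q ≥ #G`. A linear form `y` on `V` with free `G`-orbit exists, and interpolation
on the orbit gives `f ∈ S` of degree `< #G` with value `1` at `y` and `0` at the rest of the orbit.
For `W` irreducible and a linear form `l ≠ 0` on `W`, the equivariant map `x ↦ ∑ l(g⁻¹x) g f` has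
value `l x` at `y`, so it is nonzero. Its image has degree `< q`, and `𝔪^[q]` starts in degree `q`,
so it stays nonzero modulo `𝔪^[q]`. It is then injective by irreducibility and splits by Maschke
(`containsAllIrreducibles_of_card_le`). -/

noncomputable section

namespace FrobCov

universe u v w

/-! ### Reduced monomials

A monomial is reduced (with respect to `q`) if all its exponents are less than `q`. -/

section Reduced

open MvPolynomial

variable {k τ : Type*} [Field k] [Fintype τ] {q : ℕ}

/-- The exponent vector of a reduced monomial. -/
def redExp (a : τ → Fin q) : τ →₀ ℕ := Finsupp.equivFunOnFinite.symm fun i => (a i : ℕ)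

@[simp]
theorem redExp_apply (a : τ → Fin q) (i : τ) : redExp a i = a i := rfl

theorem redExp_injective : Function.Injective (redExp : (τ → Fin q) → τ →₀ ℕ) := fun _ _ h =>
  funext fun i => Fin.ext (DFunLike.congr_fun h i)

theorem exists_redExp_eq {m : τ →₀ ℕ} (hm : ∀ i, m i < q) : ∃ a : τ → Fin q, redExp a = m :=
  ⟨fun i => ⟨m i, hm i⟩, Finsupp.ext fun _ => rfl⟩

variable (k τ q) in
/-- The coefficients of the reduced monomials of a polynomial. -/
def redCoeff : MvPolynomial τ k →ₗ[k] ((τ → Fin q) → k) :=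
  LinearMap.pi fun a => lcoeff k (redExp a)

@[simp]
theorem redCoeff_apply (f : MvPolynomial τ k) (a : τ → Fin q) :
    redCoeff k τ q f a = f.coeff (redExp a) := rfl

variable (k τ q) in
/-- The ideal generated by the `q`-th powers of the variables. -/
def varPowIdeal : Ideal (MvPolynomial τ k) := Ideal.span (Set.range fun i => X i ^ q)

/-- The ideal is monomial: membership means that each monomial of `f` is divisible by some `X i ^
q`, that is, none is reduced. -/
theorem redCoeff_eq_zero_iff {f : MvPolynomial τ k} :
    redCoeff k τ q f = 0 ↔ f ∈ varPowIdeal k τ q := by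
  have h : (Set.range fun i : τ => (X i ^ q : MvPolynomial τ k)) =
      (fun s => monomial s (1 : k)) '' Set.range fun i : τ => Finsupp.single i q := by
    rw [← Set.range_comp]
    exact congrArg Set.range (funext fun i => X_pow_eq_monomial)
  rw [varPowIdeal, h, mem_ideal_span_monomial_image]
  constructor
  · intro hf m hm
    by_contra! hlt
    obtain ⟨a, rfl⟩ := exists_redExp_eq (q := q) (m := m) fun i => by
      by_contra! hi
      exact hlt _ ⟨i, rfl⟩ (Finsupp.single_le_iff.2 hi)
    exact mem_support_iff.1 hm (congrFun hf a)
  · intro hf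
    funext a
    by_contra ha
    obtain ⟨_, ⟨i, rfl⟩, hi⟩ := hf _ (mem_support_iff.2 ha)
    exact absurd (Finsupp.single_le_iff.1 hi) (not_le.2 (a i).2)

variable [DecidableEq τ]

variable (k τ q) in
/-- The linear combination of reduced monomials with given coefficients. -/
def redPoly : ((τ → Fin q) → k) →ₗ[k] MvPolynomial τ k :=
  ∑ a, monomial (redExp a) ∘ₗ LinearMap.proj a

theorem redPoly_apply (x : (τ → Fin q) → k) :
    redPoly k τ q x = ∑ a, monomial (redExp a) (x a) := by
  simp [redPoly]

theorem redPoly_single (a : τ → Fin q) :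
    redPoly k τ q (Pi.single a 1) = monomial (redExp a) 1 := by
  rw [redPoly_apply, Finset.sum_eq_single a]
  · simp
  · intro b _ hb
    simp [hb]
  · simp

@[simp]
theorem redCoeff_redPoly (x : (τ → Fin q) → k) : redCoeff k τ q (redPoly k τ q x) = x := by
  funext a
  simp [redPoly_apply, coeff_sum, coeff_monomial, redExp_injective.eq_iff]

theorem totalDegree_redPoly_redCoeff_le (f : MvPolynomial τ k) :
    (redPoly k τ q (redCoeff k τ q f)).totalDegree ≤ f.totalDegree := by
  rw [redPoly_apply]
  refine totalDegree_finsetSum_le fun a _ => ?_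
  by_cases h : f.coeff (redExp a) = 0
  · simp [h]
  · rw [redCoeff_apply, totalDegree_monomial _ h]
    exact le_totalDegree (mem_support_iff.2 h)

end Reduced

/-! ### Bases of the polynomial ring over its subring of `q`-th powers -/

section FrobeniusBasis

open MvPolynomial

variable {k τ : Type*} [Field k] [Fintype τ] (p : ℕ) [Fact p.Prime] [CharP k p] (e : ℕ)

/-- Division of exponents by `q` with remainder: `f ^ q` only has exponents divisible by `q`, so the
remainder `a` determines the reduced factor. This reads off each coefficient in the expansion in
reduced monomials. -/
theorem coeff_pow_mul_monomial_redExp (f : MvPolynomial τ k) (b : τ →₀ ℕ) (a a' : τ → Fin (p ^ e)) :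
    (f ^ p ^ e * monomial (redExp a') 1).coeff (p ^ e • b + redExp a) =
      if a' = a then f.coeff b ^ p ^ e else 0 := by
  rw [coeff_mul_monomial', ← map_iterateFrobenius_expand p f e, coeff_map, mul_one]
  have hq : p ^ e ≠ 0 := pow_ne_zero _ (Fact.out : p.Prime).ne_zero
  split_ifs with h₁ h₂ h₂
  · subst h₂
    rw [add_tsub_cancel_right, coeff_expand_smul _ hq, iterateFrobenius_def]
  · obtain ⟨i, hi⟩ := Function.ne_iff.1 h₂
    rw [coeff_expand_of_not_dvd (i := i), map_zero]
    intro hdvd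
    have hle : (a' i : ℕ) ≤ p ^ e * b i + a i := by simpa using h₁ i
    have hd : p ^ e ∣ p ^ e * b i + a i - a' i := by simpa using hdvd
    have h3 : (a' i : ℕ) ≡ p ^ e * b i + a i [MOD p ^ e] := (Nat.modEq_iff_dvd' hle).2 hd
    have h4 : (a' i : ℕ) ≡ a i [MOD p ^ e] := by
      simpa [Nat.ModEq, Nat.mul_add_mod] using h3
    exact hi (Fin.ext (h4.eq_of_lt_of_lt (a' i).2 (a i).2))
  · subst h₂
    exact absurd (le_add_of_nonneg_left zero_le) h₁
  · rfl

variable [DecidableEq τ]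

theorem sum_pow_mul_monomial_injective :
    Function.Injective fun c : (τ → Fin (p ^ e)) → MvPolynomial τ k =>
      ∑ a, c a ^ p ^ e * monomial (redExp a) 1 := by
  intro c d h
  funext a
  ext b
  have h' := congrArg (coeff (p ^ e • b + redExp a)) h
  simp only [coeff_sum, coeff_pow_mul_monomial_redExp, Finset.sum_ite_eq', Finset.mem_univ,
    if_true] at h'
  exact iterateFrobenius_inj k p e h'

/-- If each `w a` is the reduced monomial with exponents `a` up to monomials of smaller or equal
degree that are not reduced, then every polynomial is a linear combination of the `w a` with `q`-th
powers as coefficients. -/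
theorem sum_pow_mul_surjective (w : (τ → Fin (p ^ e)) → MvPolynomial τ k)
    (hdeg : ∀ a, (w a).totalDegree ≤ ∑ i, (a i : ℕ))
    (hw : ∀ a, redCoeff k τ (p ^ e) (w a - monomial (redExp a) 1) = 0)
    [PerfectRing k p] :
    Function.Surjective fun c : (τ → Fin (p ^ e)) → MvPolynomial τ k =>
      ∑ a, c a ^ p ^ e * w a := by
  have hq : p ^ e ≠ 0 := pow_ne_zero _ (Fact.out : p.Prime).ne_zero
  -- Coefficients are recorded by their `q`-th roots. Additivity of Frobenius makes `φ` additive, so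
  -- its range is a subgroup.
  let φ : ((τ → Fin (p ^ e)) → MvPolynomial τ k) →+ MvPolynomial τ k :=
    { toFun c := ∑ a, c a ^ p ^ e * w a
      map_zero' := by simp [zero_pow hq]
      map_add' c d := by
        simp [add_pow_expChar_pow, add_mul, Finset.sum_add_distrib] }
  have hφ (c) (f) : f ^ p ^ e * φ c = φ fun a => f * c a := by
    simp [φ, Finset.mul_sum, mul_pow, mul_assoc]
  have hφs (a) : φ (Pi.single a 1) = w a := by
    change ∑ b, _ = _
    rw [Finset.sum_eq_single a]
    · simp
    · intro b _ hb
      simp [hb, zero_pow hq]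
    · simp
  -- Scalars are themselves `q`-th powers, as `k` is perfect.
  have hC (c : k) {f} (hf : f ∈ φ.range) : C c * f ∈ φ.range := by
    obtain ⟨b, rfl⟩ := (iterateFrobeniusEquiv k p e).surjective c
    obtain ⟨x, rfl⟩ := hf
    rw [iterateFrobeniusEquiv_def, C_pow, hφ]
    exact ⟨_, rfl⟩
  suffices h : ∀ d (m : τ →₀ ℕ), ∑ i, m i = d → monomial m 1 ∈ φ.range by
    intro f
    change f ∈ φ.range
    rw [f.as_sum]
    refine sum_mem fun m _ => ?_
    have := hC (f.coeff m) (h _ m rfl)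
    rwa [C_mul_monomial, mul_one] at this
  intro d
  induction d using Nat.strong_induction_on with
  | _ d ih =>
  -- A non-reduced monomial is `X i ^ q` times one of strictly smaller degree, so induction applies.
  have hnr (m : τ →₀ ℕ) (hm : ∑ i, m i ≤ d) (i : τ) (hi : p ^ e ≤ m i) :
      monomial m 1 ∈ φ.range := by
    have hle : Finsupp.single i (p ^ e) ≤ m := Finsupp.single_le_iff.2 hi
    obtain ⟨m', rfl⟩ := exists_add_of_le hle
    have hs : ∑ j, (Finsupp.single i (p ^ e) + m') j = p ^ e + ∑ j, m' j := by
      simp [Finset.sum_add_distrib, Finsupp.single_apply]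
    obtain ⟨x, hx⟩ := ih (∑ j, m' j) (by omega) m' rfl
    have : monomial (Finsupp.single i (p ^ e) + m') (1 : k) = X i ^ p ^ e * monomial m' 1 := by
      rw [X_pow_eq_monomial, monomial_mul, one_mul]
    rw [this, ← hx, hφ]
    exact ⟨_, rfl⟩
  intro m hm
  by_cases hred : ∀ i, m i < p ^ e
  · obtain ⟨a, rfl⟩ := exists_redExp_eq hred
    -- The correction term involves only non-reduced monomials of degree at most `d`, which `hnr`
    -- covers.
    have : monomial (redExp a) 1 = w a - (w a - monomial (redExp a) 1) := by ring
    rw [this]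
    refine sub_mem ⟨_, hφs a⟩ ?_
    have hd : (w a - monomial (redExp a) 1).totalDegree ≤ d := by
      refine (totalDegree_sub _ _).trans (max_le ?_ ?_)
      · exact (hdeg a).trans hm.le
      · rw [totalDegree_monomial _ one_ne_zero, Finsupp.sum_fintype _ _ fun _ => rfl, hm]
    set f := w a - monomial (redExp a) 1 with hf
    rw [f.as_sum]
    refine sum_mem fun m hmf => ?_
    have hmd : ∑ i, m i ≤ d := by
      have := (le_totalDegree hmf).trans hd
      rwa [Finsupp.sum_fintype _ _ fun _ => rfl] at this
    have hnot : ¬ ∀ i, m i < p ^ e := by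
      intro hm'
      obtain ⟨b, rfl⟩ := exists_redExp_eq hm'
      exact mem_support_iff.1 hmf (congrFun (hw a) b)
    push Not at hnot
    obtain ⟨i, hi⟩ := hnot
    have := hC (f.coeff m) (hnr m hmd i hi)
    rwa [C_mul_monomial, mul_one] at this
  · push Not at hred
    obtain ⟨i, hi⟩ := hred
    exact hnr m hm.le i hi

theorem sum_pow_mul_bijective (w : (τ → Fin (p ^ e)) → MvPolynomial τ k)
    (hdeg : ∀ a, (w a).totalDegree ≤ ∑ i, (a i : ℕ))
    (hw : ∀ a, redCoeff k τ (p ^ e) (w a - monomial (redExp a) 1) = 0)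
    [PerfectRing k p] :
    Function.Bijective fun c : (τ → Fin (p ^ e)) → MvPolynomial τ k =>
      ∑ a, c a ^ p ^ e * w a := by
  refine ⟨?_, sum_pow_mul_surjective p e w hdeg hw⟩
  have hsurj₀ := sum_pow_mul_surjective p e (fun a : τ → Fin (p ^ e) => monomial (redExp a) (1 : k))
    (fun a => by
      rw [totalDegree_monomial _ one_ne_zero, Finsupp.sum_fintype _ _ fun _ => rfl]; rfl)
    (fun a => by simp)
  -- `M` is the matrix of `q`-th roots of the coefficients of the `w a` in the reduced monomials.
  -- Passing to `q`-th roots makes the change of basis linear over the polynomial ring; being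
  -- surjective on a finite free module, it is injective.
  choose N hN using fun a => hsurj₀ (w a)
  let M : Matrix (τ → Fin (p ^ e)) (τ → Fin (p ^ e)) (MvPolynomial τ k) := Matrix.of N
  have key (c : (τ → Fin (p ^ e)) → MvPolynomial τ k) :
      ∑ a, c a ^ p ^ e * w a = ∑ b, Matrix.vecMulLinear M c b ^ p ^ e * monomial (redExp b) 1 := by
    simp only [Matrix.vecMulLinear_apply, Matrix.vecMul, dotProduct, sum_pow_char_pow, mul_pow,
      Finset.sum_mul]
    rw [Finset.sum_comm]
    refine Finset.sum_congr rfl fun a _ => ?_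
    rw [← hN a, Finset.mul_sum]
    refine Finset.sum_congr rfl fun b _ => ?_
    simp [M, mul_assoc]
  have hM : Function.Injective (Matrix.vecMulLinear M) := by
    refine OrzechProperty.injective_of_surjective_endomorphism _ fun c => ?_
    obtain ⟨d, hd⟩ := sum_pow_mul_surjective p e w hdeg hw
      (∑ b, c b ^ p ^ e * monomial (redExp b) 1)
    refine ⟨d, sum_pow_mul_monomial_injective p e ?_⟩
    simp only at hd ⊢
    rw [← key, hd]
  intro c d h
  simp only [key] at h
  exact hM (sum_pow_mul_monomial_injective p e h)

end FrobeniusBasis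

/-! ### Functoriality of modules of covariants -/

section Covariants

variable {k : Type u} [Field k] {A : Type v} [CommRing A] [Algebra k A]
  {G : Type w} [Group G] (σ : G →* (A →ₐ[k] A)) (p : ℕ) [Fact p.Prime] [CharP k p] [PerfectRing k p]
  (e : ℕ) {U U' : Type u} [AddCommGroup U] [Module k U] [AddCommGroup U'] [Module k U']
  {ρ : Representation k G U} {ρ' : Representation k G U'}

/-- The map `A ^ q ⊗ U → A ^ q ⊗ U'` induced by a linear map `U → U'`. -/
def sqTensorMap (f : U →ₗ[k] U') : SqMod σ p e ⊗[k] U →ₗ[Rq σ p e] SqMod σ p e ⊗[k] U' :=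
  TensorProduct.AlgebraTensorModule.map LinearMap.id f

@[simp]
theorem sqTensorMap_tmul (f : U →ₗ[k] U') (x : SqMod σ p e) (z : U) :
    sqTensorMap σ p e f (x ⊗ₜ z) = x ⊗ₜ f z := rfl

theorem sqTensorMap_tprod (f : ρ.IntertwiningMap ρ') (g : G) (x : SqMod σ p e ⊗[k] U) :
    sqTensorMap σ p e f.toLinearMap ((SqRep σ p e).tprod ρ g x) =
      (SqRep σ p e).tprod ρ' g (sqTensorMap σ p e f.toLinearMap x) := by
  induction x with
  | zero => simp only [map_zero]
  | add x y hx hy => simp only [map_add, hx, hy]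
  | tmul x z =>
    have h : f.toLinearMap (ρ g z) = ρ' g (f.toLinearMap z) := congr($(f.isIntertwining' g) z)
    rw [Representation.tprod_apply, Representation.tprod_apply, TensorProduct.map_tmul,
      sqTensorMap_tmul, sqTensorMap_tmul, TensorProduct.map_tmul, h]

/-- The map of modules of covariants induced by a map of representations. -/
def covariantsMap (f : ρ.IntertwiningMap ρ') :
    covariants σ p e ρ →ₗ[Rq σ p e] covariants σ p e ρ' :=
  (sqTensorMap σ p e f.toLinearMap).restrict (p := covariants σ p e ρ) (q := covariants σ p e ρ')
    fun x hx g => by rw [← sqTensorMap_tprod, hx g]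

theorem IsDirectSummandRep.covariants (h : IsDirectSummandRep ρ ρ') :
    IsDirectSummand (Rq σ p e) (covariants σ p e ρ) (covariants σ p e ρ') := by
  obtain ⟨i, r, h⟩ := h
  refine ⟨covariantsMap σ p e i, covariantsMap σ p e r, LinearMap.ext fun x => Subtype.ext ?_⟩
  change sqTensorMap σ p e r.toLinearMap (sqTensorMap σ p e i.toLinearMap x.1) = x.1
  induction x.1 with
  | zero => simp only [map_zero]
  | add x y hx hy => simp only [map_add, hx, hy]
  | tmul x z =>
    rw [sqTensorMap_tmul, sqTensorMap_tmul]
    exact congrArg _ (h z)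

theorem IsDirectSummand.congr_right {R M N N' : Type*} [CommRing R] [AddCommMonoid M]
    [AddCommMonoid N] [AddCommMonoid N'] [Module R M] [Module R N] [Module R N']
    (h : IsDirectSummand R M N) (f : N ≃ₗ[R] N') : IsDirectSummand R M N' := by
  obtain ⟨i, r, h⟩ := h
  refine ⟨f ∘ₗ i, r ∘ₗ f.symm, LinearMap.ext fun x => ?_⟩
  simpa using congr($h x)

/-- The multiplication map `A ^ q ⊗ U → A`, `a ⊗ x ↦ a ψ(x)`. -/
def mulMap (ψ : U →ₗ[k] A) : SqMod σ p e ⊗[k] U →ₗ[Rq σ p e] A :=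
  TensorProduct.AlgebraTensorModule.lift
    { toFun x := LinearMap.mulLeft k (x : A) ∘ₗ ψ
      map_add' x y := LinearMap.ext fun z => add_mul (x : A) y (ψ z)
      map_smul' r x := LinearMap.ext fun z => mul_assoc (r : A) (x : A) (ψ z) }

@[simp]
theorem mulMap_tmul (ψ : U →ₗ[k] A) (x : SqMod σ p e) (z : U) :
    mulMap σ p e ψ (x ⊗ₜ z) = x * ψ z := rfl

theorem mulMap_tprod (ψ : ρ.IntertwiningMap (linRep σ)) (g : G) (x : SqMod σ p e ⊗[k] U) :
    mulMap σ p e ψ.toLinearMap ((SqRep σ p e).tprod ρ g x) =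
      σ g (mulMap σ p e ψ.toLinearMap x) := by
  induction x with
  | zero => simp
  | add x y hx hy => simp only [map_add, hx, hy]
  | tmul x z =>
    have h : ψ.toLinearMap (ρ g z) = σ g (ψ.toLinearMap z) := congr($(ψ.isIntertwining' g) z)
    rw [Representation.tprod_apply, TensorProduct.map_tmul, mulMap_tmul, mulMap_tmul, h, map_mul]
    rfl

/-- If multiplication is a `G`-equivariant bijection `A ^ q ⊗ U → A`, then `A ^ G` is the module of
covariants of `U`. -/
def covariantsEquiv (ψ : ρ.IntertwiningMap (linRep σ))
    (h : Function.Bijective (mulMap σ p e ψ.toLinearMap)) :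
    covariants σ p e ρ ≃ₗ[Rq σ p e] RMod σ p e :=
  LinearEquiv.ofBijective
    ((mulMap σ p e ψ.toLinearMap).restrict
      (p := covariants σ p e ρ) (q := RMod σ p e) fun x hx g => by rw [← mulMap_tprod, hx g]) (by
      constructor
      · intro x y hxy
        exact Subtype.ext (h.1 congr(($hxy).1))
      · rintro ⟨y, hy⟩
        obtain ⟨x, rfl⟩ := h.2 y
        refine ⟨⟨x, fun g => h.1 ?_⟩, rfl⟩
        rw [mulMap_tprod, hy g])

/-- An element of `A ^ q ⊗ k ^ ι` is a tuple of `q`-th powers. Roots need not be unique in `A`;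
surjectivity of `P` suffices. -/
theorem mulMap_bijective {ι : Type} [Fintype ι] [DecidableEq ι] (ψ : (ι → k) →ₗ[k] A)
    (h : Function.Bijective fun c : ι → A => ∑ a, c a ^ p ^ e * ψ (Pi.single a 1)) :
    Function.Bijective (mulMap σ p e ψ) := by
  let P : (ι → A) → SqMod σ p e ⊗[k] (ι → k) := fun c =>
    (TensorProduct.piScalarRight k k (SqMod σ p e) ι).symm fun a => ⟨c a ^ p ^ e, c a, trivial, rfl⟩
  have hP : Function.Surjective P := by
    intro x
    obtain ⟨y, rfl⟩ := (TensorProduct.piScalarRight k k (SqMod σ p e) ι).symm.surjective x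
    choose c _ hc using fun a => (y a).2
    exact ⟨c, congrArg _ (funext fun a => Subtype.ext (hc a))⟩
  have hmul (c : ι → A) : mulMap σ p e ψ (P c) = ∑ a, c a ^ p ^ e * ψ (Pi.single a 1) := by
    simp only [P]
    rw [← Finset.univ_sum_single (fun a => (⟨c a ^ p ^ e, c a, trivial, rfl⟩ : SqMod σ p e)),
      map_sum, map_sum]
    simp
  constructor
  · intro x y hxy
    obtain ⟨c, rfl⟩ := hP x
    obtain ⟨d, rfl⟩ := hP y
    rw [hmul, hmul] at hxy
    rw [h.1 hxy]
  · intro y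
    obtain ⟨c, rfl⟩ := h.2 y
    exact ⟨P c, hmul c⟩

end Covariants

/-! ### Averaging -/

section Average

variable {k G U W : Type*} [Field k] [Group G] [Fintype G] [AddCommGroup U] [Module k U]
  [AddCommGroup W] [Module k W] (ρ : Representation k G U) (τ : Representation k G W)

/-- The average of a linear map between two representations of a finite group. -/
def averageMap (f : U →ₗ[k] W) : ρ.IntertwiningMap τ where
  toLinearMap := (Fintype.card G : k)⁻¹ • ∑ g, τ g ∘ₗ f ∘ₗ ρ g⁻¹
  isIntertwining' h := by
    ext x
    simp only [LinearMap.comp_apply, LinearMap.smul_apply, LinearMap.sum_apply, map_smul, map_sum]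
    congr 1
    refine Fintype.sum_equiv (Equiv.mulLeft h⁻¹) _ _ fun g => ?_
    simp only [Equiv.coe_mulLeft, mul_inv_rev, inv_inv, map_mul, Module.End.mul_apply]
    rw [← Module.End.mul_apply (τ h), ← map_mul, mul_inv_cancel, map_one, Module.End.one_apply]

theorem averageMap_apply (f : U →ₗ[k] W) (x : U) :
    averageMap ρ τ f x = (Fintype.card G : k)⁻¹ • ∑ g, τ g (f (ρ g⁻¹ x)) := by
  change ((Fintype.card G : k)⁻¹ • ∑ g, τ g ∘ₗ f ∘ₗ ρ g⁻¹) x = _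
  simp

variable {ρ τ}

/-- Since `κ` is equivariant, every conjugate of a linear section of `κ` is again a section, hence
so is their average. -/
theorem apply_averageMap (hG : (Fintype.card G : k) ≠ 0) (κ : τ.IntertwiningMap ρ)
    (f : U →ₗ[k] W) (h : ∀ x, κ (f x) = x) (x : U) : κ (averageMap ρ τ f x) = x := by
  have hκ (g : G) (y : W) : κ (τ g y) = ρ g (κ y) := congr($(κ.isIntertwining' g) y)
  have hg (g : G) : ρ g (ρ g⁻¹ x) = x := by
    rw [← Module.End.mul_apply, ← map_mul, mul_inv_cancel, map_one, Module.End.one_apply]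
  rw [averageMap_apply, map_smul, map_sum]
  simp only [hκ, h, hg, Finset.sum_const, Finset.card_univ]
  rw [← Nat.cast_smul_eq_nsmul k, smul_smul, inv_mul_cancel₀ hG, one_smul]

theorem averageMap_apply_apply (hG : (Fintype.card G : k) ≠ 0) (i : τ.IntertwiningMap ρ)
    (f : U →ₗ[k] W) (h : ∀ x, f (i x) = x) (x : W) : averageMap ρ τ f (i x) = x := by
  have hi (g : G) (y : W) : ρ g (i y) = i (τ g y) := congr($(i.isIntertwining' g) y).symm
  have hg (g : G) : τ g (τ g⁻¹ x) = x := by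
    rw [← Module.End.mul_apply, ← map_mul, mul_inv_cancel, map_one, Module.End.one_apply]
  rw [averageMap_apply]
  simp only [hi, h, hg, Finset.sum_const, Finset.card_univ]
  rw [← Nat.cast_smul_eq_nsmul k, smul_smul, inv_mul_cancel₀ hG, one_smul]

/-- Maschke's theorem: a subrepresentation is a direct summand. -/
theorem isDirectSummandRep_of_injective (hG : (Fintype.card G : k) ≠ 0)
    (i : τ.IntertwiningMap ρ) (hi : Function.Injective i) : IsDirectSummandRep τ ρ := by
  obtain ⟨r, hr⟩ := i.toLinearMap.exists_leftInverse_of_injective (LinearMap.ker_eq_bot.2 hi)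
  exact ⟨i, averageMap ρ τ r, averageMap_apply_apply hG i r fun x => congr($hr x)⟩

end Average

/-! ### Representations transported along a split surjection -/

section Transport

variable {k G U W : Type*} [Field k] [Group G] [AddCommGroup U] [Module k U]
  [AddCommGroup W] [Module k W] (τ : Representation k G W) (κ : W →ₗ[k] U) (s : U →ₗ[k] W)

theorem apply_rep_section (hs : ∀ x, κ (s x) = x) (hκ : ∀ g x, κ x = 0 → κ (τ g x) = 0)
    (g : G) (x : W) : κ (τ g (s (κ x))) = κ (τ g x) := by
  rw [← sub_eq_zero, ← map_sub, ← map_sub]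
  exact hκ g _ (by rw [map_sub, hs, sub_self])

variable (hs : ∀ x, κ (s x) = x) (hκ : ∀ g x, κ x = 0 → κ (τ g x) = 0)

/-- The representation on `U` induced along a split surjection `κ : W → U` with stable kernel. -/
def inducedRep : Representation k G U where
  toFun g := κ ∘ₗ τ g ∘ₗ s
  map_one' := LinearMap.ext fun x => by simp [hs]
  map_mul' g h := LinearMap.ext fun x => by
    simp only [LinearMap.comp_apply, Module.End.mul_apply, map_mul]
    rw [apply_rep_section τ κ s hs hκ]

/-- The split surjection as a map of representations. -/
def inducedRepMap : τ.IntertwiningMap (inducedRep τ κ s hs hκ) where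
  toLinearMap := κ
  isIntertwining' g := LinearMap.ext fun x => (apply_rep_section τ κ s hs hκ g x).symm

end Transport

/-! ### Invariants of the symmetric algebra as a module of covariants -/

section Coordinates

open MvPolynomial SymmetricAlgebra Module

variable {k : Type u} [Field k] {V : Type v} [AddCommGroup V] [Module k V]
  {τ : Type}

theorem totalDegree_map_le_of_totalDegree_X_le {R : Type*} [CommRing R]
    (θ : MvPolynomial τ R →ₐ[R] MvPolynomial τ R) (h : ∀ i, (θ (X i)).totalDegree ≤ 1)
    (f : MvPolynomial τ R) : (θ f).totalDegree ≤ f.totalDegree := by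
  conv_lhs => rw [f.as_sum]
  rw [map_sum]
  refine totalDegree_finsetSum_le fun m hm => ?_
  rw [monomial_eq, map_mul, ← algebraMap_eq, AlgHom.commutes, algebraMap_eq, Finsupp.prod, map_prod]
  refine (totalDegree_mul _ _).trans ?_
  rw [totalDegree_C, zero_add]
  refine (totalDegree_finsetProd _ _).trans (le_trans ?_ (le_totalDegree hm))
  refine Finset.sum_le_sum fun i _ => ?_
  rw [map_pow]
  exact (totalDegree_pow _ _).trans (by simpa using Nat.mul_le_mul_left (m i) (h i))

variable [Fintype τ] (b : Basis τ k V)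

theorem equivMvPolynomial_ι_eq_sum (x : V) :
    equivMvPolynomial b (ι k V x) = ∑ i, C (b.repr x i) * X i := by
  conv_lhs => rw [← b.sum_repr x]
  simp only [map_sum, map_smul, equivMvPolynomial_ι_apply, smul_eq_C_mul]

/-- As `q`-th powering is a ring homomorphism, the `q`-th powers of generators of `𝔪` already
generate `𝔪^[q]`. -/
theorem mem_frobPower_iff (p : ℕ) [Fact p.Prime] [CharP k p] (e : ℕ) {x : SymmetricAlgebra k V} :
    x ∈ frobPower k V (p ^ e) ↔ equivMvPolynomial b x ∈ varPowIdeal k τ (p ^ e) := by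
  constructor
  · suffices h : frobPower k V (p ^ e) ≤
        (varPowIdeal k τ (p ^ e)).comap (equivMvPolynomial b) from fun hx => h hx
    have hm : maxIdeal k V ≤ (varPowIdeal k τ (p ^ e)).comap
        ((iterateFrobenius (MvPolynomial τ k) p e).comp
          (equivMvPolynomial b : SymmetricAlgebra k V →+* MvPolynomial τ k)) := by
      refine Ideal.span_le.2 ?_
      rintro _ ⟨x, rfl⟩
      change iterateFrobenius _ p e (equivMvPolynomial b (ι k V x)) ∈ varPowIdeal k τ (p ^ e)
      rw [equivMvPolynomial_ι_eq_sum, map_sum]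
      refine sum_mem fun i _ => ?_
      rw [map_mul, iterateFrobenius_def _ _ (X i)]
      exact Ideal.mul_mem_left _ _ (Ideal.subset_span ⟨i, rfl⟩)
    refine Ideal.span_le.2 ?_
    rintro _ ⟨f, hf, rfl⟩
    have := hm hf
    simpa [iterateFrobenius_def] using this
  · suffices h : varPowIdeal k τ (p ^ e) ≤
        (frobPower k V (p ^ e)).comap (equivMvPolynomial b).symm by
      intro hx
      have := h hx
      rwa [Ideal.mem_comap, AlgEquiv.symm_apply_apply] at this
    refine Ideal.span_le.2 ?_
    rintro _ ⟨i, rfl⟩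
    refine Ideal.subset_span ⟨ι k V (b i), Ideal.subset_span ⟨_, rfl⟩, ?_⟩
    rw [map_pow, equivMvPolynomial_symm_X]

theorem totalDegree_symAction_le (G : Subgroup (LinearMap.GeneralLinearGroup k V)) (g : G)
    (x : SymmetricAlgebra k V) :
    (equivMvPolynomial b (symAction G g x)).totalDegree ≤ (equivMvPolynomial b x).totalDegree := by
  have h := totalDegree_map_le_of_totalDegree_X_le
    ((equivMvPolynomial b : SymmetricAlgebra k V →ₐ[k] MvPolynomial τ k).comp
      ((symAction G g).comp ((equivMvPolynomial b).symm : MvPolynomial τ k →ₐ[k] _)))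
    (fun i => ?_) (equivMvPolynomial b x)
  · simpa using h
  · have : symAction G g (ι k V (b i)) =
        ι k V (((g : LinearMap.GeneralLinearGroup k V) : V →ₗ[k] V) (b i)) := lift_ι_apply _ _
    change (equivMvPolynomial b (symAction G g ((equivMvPolynomial b).symm (X i)))).totalDegree ≤ 1
    rw [equivMvPolynomial_symm_X, this, equivMvPolynomial_ι_eq_sum]
    refine totalDegree_finsetSum_le fun j _ => ?_
    refine (totalDegree_mul _ _).trans ?_
    rw [totalDegree_C, totalDegree_X]

end Coordinates

/-! ### The equivariant lift of `S / 𝔪^{[q]}` to `S` -/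

section Invariants

open MvPolynomial SymmetricAlgebra Module

variable {k : Type u} [Field k] {V : Type v} [AddCommGroup V] [Module k V]
  (p : ℕ) [Fact p.Prime] [CharP k p] (e : ℕ) (G : Subgroup (LinearMap.GeneralLinearGroup k V))
  {τ : Type} [Fintype τ] (b : Basis τ k V)

/-- The coefficients of the reduced monomials of an element of the symmetric algebra. -/
def symCoeff (q : ℕ) : SymmetricAlgebra k V →ₗ[k] ((τ → Fin q) → k) :=
  redCoeff k τ q ∘ₗ (equivMvPolynomial b).toLinearMap

theorem symCoeff_eq_zero_iff {x : SymmetricAlgebra k V} :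
    symCoeff b (p ^ e) x = 0 ↔ x ∈ frobPower k V (p ^ e) := by
  rw [mem_frobPower_iff b, ← redCoeff_eq_zero_iff]
  rfl

theorem symCoeff_symAction_eq_zero (g : G) (x : SymmetricAlgebra k V)
    (hx : symCoeff b (p ^ e) x = 0) :
    symCoeff b (p ^ e) (linRep (symAction G) g x) = 0 :=
  (symCoeff_eq_zero_iff p e b).2
    (symAction_mem_frobPower G _ g ((symCoeff_eq_zero_iff p e b).1 hx))

variable [DecidableEq τ]

/-- The linear combination of reduced monomials with given coefficients. -/
def symPoly (q : ℕ) : ((τ → Fin q) → k) →ₗ[k] SymmetricAlgebra k V :=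
  (equivMvPolynomial b).symm.toLinearMap ∘ₗ redPoly k τ q

theorem symCoeff_symPoly {q : ℕ} (x : (τ → Fin q) → k) : symCoeff b q (symPoly b q x) = x := by
  simp [symCoeff, symPoly, -redCoeff_apply]

/-- The representation of `G` on `S / 𝔪^{[q]}` in the coordinates given by the reduced monomials. -/
def symRep : Representation k G ((τ → Fin (p ^ e)) → k) :=
  inducedRep (linRep (symAction G)) (symCoeff b (p ^ e)) (symPoly b (p ^ e)) (symCoeff_symPoly b)
    (symCoeff_symAction_eq_zero p e G b)

/-- Reduction modulo `𝔪^{[q]}` in coordinates, as a map of representations. -/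
def symRepMap : (linRep (symAction G)).IntertwiningMap (symRep p e G b) :=
  inducedRepMap _ _ _ _ _

variable [Fintype G]

/-- The equivariant section of the reduction modulo `𝔪^{[q]}`. -/
def symSection : (symRep p e G b).IntertwiningMap (linRep (symAction G)) :=
  averageMap _ _ (symPoly b (p ^ e))

theorem symCoeff_symSection (hG : (Fintype.card G : k) ≠ 0) (x : (τ → Fin (p ^ e)) → k) :
    symCoeff b (p ^ e) (symSection p e G b x) = x :=
  apply_averageMap hG (symRepMap p e G b) (symPoly b (p ^ e)) (symCoeff_symPoly b) x

/-- Neither the linear substitutions by `G` nor the truncation to reduced monomials raises the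
degree. This is the degree hypothesis of `sum_pow_mul_bijective`. -/
theorem totalDegree_symSection_le (x : (τ → Fin (p ^ e)) → k) :
    (equivMvPolynomial b (symSection p e G b x)).totalDegree ≤
      (redPoly k τ (p ^ e) x).totalDegree := by
  rw [symSection, averageMap_apply, map_smul, map_sum]
  refine (totalDegree_smul_le _ _).trans (totalDegree_finsetSum_le fun g _ => ?_)
  refine (totalDegree_symAction_le b G g _).trans ?_
  have h : equivMvPolynomial b (symPoly b (p ^ e) (symRep p e G b g⁻¹ x)) =
      redPoly k τ (p ^ e) (redCoeff k τ (p ^ e)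
        (equivMvPolynomial b (symAction G g⁻¹ (symPoly b (p ^ e) x)))) :=
    (equivMvPolynomial b).apply_symm_apply _
  rw [h]
  refine (totalDegree_redPoly_redCoeff_le _).trans ((totalDegree_symAction_le b G _ _).trans ?_)
  rw [symPoly, LinearMap.comp_apply, AlgEquiv.toLinearMap_apply, AlgEquiv.apply_symm_apply]

theorem symSection_bijective [PerfectRing k p] (hG : (Fintype.card G : k) ≠ 0) :
    Function.Bijective (mulMap (symAction G) p e (symSection p e G b).toLinearMap) := by
  refine mulMap_bijective _ p e _ ?_
  have h := sum_pow_mul_bijective p e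
    (fun a => equivMvPolynomial b (symSection p e G b (Pi.single a 1)))
    (fun a => (totalDegree_symSection_le p e G b _).trans_eq ?_) fun a => ?_
  · have h2 := (equivMvPolynomial b).symm.bijective.comp
      (h.comp (Function.Bijective.comp_left (equivMvPolynomial b).bijective))
    convert h2 using 1
    funext c
    simp
  · rw [redPoly_single, totalDegree_monomial _ one_ne_zero, Finsupp.sum_fintype _ _ fun _ => rfl]
    rfl
  · rw [map_sub, sub_eq_zero, ← redPoly_single, redCoeff_redPoly]
    exact symCoeff_symSection p e G b hG _

/-- `symRep` is a coordinate model of `frobQuotRep`; the identity `s ∘ κ = id` is enough to carry a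
summand over. -/
theorem isDirectSummandRep_symRep (hG : (Fintype.card G : k) ≠ 0) {W : Type*} [AddCommGroup W]
    [Module k W] {ρ : Representation k G W} (h : IsDirectSummandRep ρ (frobQuotRep G (p ^ e))) :
    IsDirectSummandRep ρ (symRep p e G b) := by
  obtain ⟨i, r, hri⟩ := h
  let I := (frobPower k V (p ^ e)).restrictScalars k
  let κ : (frobQuotRep G (p ^ e)).IntertwiningMap (symRep p e G b) :=
    { toLinearMap := I.liftQ (symCoeff b (p ^ e)) fun x hx => (symCoeff_eq_zero_iff p e b).2 hx
      isIntertwining' g := by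
        refine Submodule.linearMap_qext _ (LinearMap.ext fun x => ?_)
        exact congr($((symRepMap p e G b).isIntertwining' g) x) }
  let s : (symRep p e G b).IntertwiningMap (frobQuotRep G (p ^ e)) :=
    { toLinearMap := I.mkQ ∘ₗ (symSection p e G b).toLinearMap
      isIntertwining' g := LinearMap.ext fun x =>
        congrArg I.mkQ congr($((symSection p e G b).isIntertwining' g) x) }
  have hs (x) : s (κ x) = x := by
    obtain ⟨x, rfl⟩ := I.mkQ_surjective x
    refine (Submodule.Quotient.eq I).2 ((symCoeff_eq_zero_iff p e b).1 ?_)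
    rw [map_sub, sub_eq_zero]
    exact symCoeff_symSection p e G b hG _
  refine ⟨κ.comp i, r.comp s, fun x => ?_⟩
  change r (s (κ (i x))) = x
  rw [hs, hri]

theorem ContainsAllIrreducibles.invariantsFull [FiniteDimensional k V] [PerfectRing k p]
    (hG : (Fintype.card G : k) ≠ 0) (h : ContainsAllIrreducibles G (p ^ e)) :
    InvariantsFull G p e := by
  -- The index type `Fin n` lies in `Type`, so `symRep` lives in the universe of `k`, as
  -- `covariants` requires.
  let b := Module.finBasis k V
  let E := covariantsEquiv _ p e (symSection p e G b) (symSection_bijective p e G b hG)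
  exact ⟨⟨_, _, _, inferInstance, symRep p e G b, ⟨E.symm⟩⟩, fun W _ _ ρ hρ =>
    ((isDirectSummandRep_symRep p e G b hG (h W ρ hρ)).covariants _ p e).congr_right E⟩

end Invariants

/-! ### Irreducible representations in `S / 𝔪^{[q]}` -/

section Irreducibles

open SymmetricAlgebra

variable {k : Type u} [Field k] {V : Type v} [AddCommGroup V] [Module k V]
  (G : Subgroup (LinearMap.GeneralLinearGroup k V))

theorem symAction_ι (g : G) (x : V) : symAction G g (ι k V x) =
    ι k V (((g : LinearMap.GeneralLinearGroup k V) : V →ₗ[k] V) x) := lift_ι_apply _ _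

variable (k V) in
/-- The grading of the symmetric algebra as a coaction: `v ↦ v X` for `v ∈ V`. -/
def gradingHom : SymmetricAlgebra k V →ₐ[k] Polynomial (SymmetricAlgebra k V) :=
  lift ((Polynomial.monomial 1).restrictScalars k ∘ₗ ι k V)

theorem gradingHom_ι (x : V) : gradingHom k V (ι k V x) = Polynomial.C (ι k V x) * Polynomial.X := by
  rw [gradingHom, lift_ι_apply, Polynomial.C_mul_X_eq_monomial]
  rfl

theorem eval_one_gradingHom (x : SymmetricAlgebra k V) : (gradingHom k V x).eval 1 = x := by
  induction x using SymmetricAlgebra.induction with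
  | algebraMap r => rw [AlgHom.commutes, Polynomial.algebraMap_apply, Polynomial.eval_C]
  | ι x => simp [gradingHom_ι]
  | mul x y hx hy => rw [map_mul, Polynomial.eval_mul, hx, hy]
  | add x y hx hy => rw [map_add, Polynomial.eval_add, hx, hy]

theorem gradingHom_symAction (g : G) (x : SymmetricAlgebra k V) :
    gradingHom k V (symAction G g x) =
      (gradingHom k V x).map (symAction G g : SymmetricAlgebra k V →+* _) := by
  induction x using SymmetricAlgebra.induction with
  | algebraMap r => simp [Polynomial.algebraMap_apply]
  | ι x => simp [gradingHom_ι, symAction_ι]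
  | mul x y hx hy => rw [map_mul, map_mul, map_mul, Polynomial.map_mul, hx, hy]
  | add x y hx hy => rw [map_add, map_add, map_add, Polynomial.map_add, hx, hy]

theorem X_pow_dvd_gradingHom {q : ℕ} {x : SymmetricAlgebra k V} (hx : x ∈ frobPower k V q) :
    Polynomial.X ^ q ∣ gradingHom k V x := by
  have hm : maxIdeal k V ≤ (Ideal.span {Polynomial.X}).comap (gradingHom k V) := by
    refine Ideal.span_le.2 ?_
    rintro _ ⟨x, rfl⟩
    refine Ideal.mem_span_singleton.2 ?_
    rw [gradingHom_ι]
    exact dvd_mul_left _ _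
  suffices h : frobPower k V q ≤ (Ideal.span {Polynomial.X ^ q}).comap (gradingHom k V) from
    Ideal.mem_span_singleton.1 (h hx)
  refine Ideal.span_le.2 ?_
  rintro _ ⟨f, hf, rfl⟩
  refine Ideal.mem_span_singleton.2 ?_
  rw [map_pow]
  exact pow_dvd_pow_of_dvd (Ideal.mem_span_singleton.1 (hm hf)) q

/-- The coefficient of `X ^ i` in `gradingHom k V x` is the degree-`i` component of `x`, and
elements of `𝔪^[q]` have none below degree `q`. -/
theorem eq_zero_of_mem_frobPower {q : ℕ} {x : SymmetricAlgebra k V} (hx : x ∈ frobPower k V q)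
    (hd : (gradingHom k V x).natDegree < q) : x = 0 := by
  rw [← eval_one_gradingHom x]
  suffices h : gradingHom k V x = 0 by rw [h, Polynomial.eval_zero]
  ext1 i
  rw [Polynomial.coeff_zero]
  rcases lt_or_ge i q with hi | hi
  · exact Polynomial.X_pow_dvd_iff.1 (X_pow_dvd_gradingHom hx) i hi
  · exact Polynomial.coeff_eq_zero_of_natDegree_lt (hd.trans_le hi)

/-- Evaluation of elements of the symmetric algebra at a linear form. -/
def symEval (y : V →ₗ[k] k) : SymmetricAlgebra k V →ₐ[k] k := lift y

theorem symEval_symAction (y : V →ₗ[k] k) (g : G) (x : SymmetricAlgebra k V) :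
    symEval y (symAction G g x) =
      symEval (y ∘ₗ ((g : LinearMap.GeneralLinearGroup k V) : V →ₗ[k] V)) x := by
  rw [← AlgHom.comp_apply]
  congr 1
  refine algHom_ext (LinearMap.ext fun x => ?_)
  simp [symEval, symAction_ι]

/-- Some linear form has trivial stabilizer. -/
theorem exists_linearForm_trivial_stabilizer [Infinite k] [Finite G] :
    ∃ y : V →ₗ[k] k, ∀ g : G, g ≠ 1 →
      y ∘ₗ ((g : LinearMap.GeneralLinearGroup k V) : V →ₗ[k] V) ≠ y := by
  classical
  cases nonempty_fintype G
  -- `T g` is the space of linear forms fixed by `g`, proper for `g ≠ 1` because `G` acts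
  -- faithfully. Finitely many proper subspaces cannot cover the dual over an infinite field.
  let T (g : G) : Submodule k (Module.Dual k V) :=
    LinearMap.ker (Module.Dual.transpose (R := k)
      (((g : LinearMap.GeneralLinearGroup k V) : V →ₗ[k] V) - LinearMap.id))
  let s : Finset (Submodule k (Module.Dual k V)) := (Finset.univ.filter fun g : G => g ≠ 1).image T
  have hs : ⊤ ∉ s := by
    intro h
    obtain ⟨g, hg, hT⟩ := Finset.mem_image.1 h
    refine (Finset.mem_filter.1 hg).2 (Subtype.ext (Units.ext (LinearMap.ext fun x => ?_)))
    refine sub_eq_zero.1 ((Module.forall_dual_apply_eq_zero_iff k _).1 fun y => ?_)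
    have hy : y ∈ T g := hT ▸ Submodule.mem_top
    exact congr($(LinearMap.mem_ker.1 hy) x)
  obtain ⟨y, hy⟩ := (Set.ne_univ_iff_exists_notMem _).1 (Subspace.biUnion_ne_univ_of_top_notMem hs)
  refine ⟨y, fun g hg hgy => hy ?_⟩
  refine Set.mem_biUnion (Finset.mem_image_of_mem T (Finset.mem_filter.2 ⟨Finset.mem_univ g, hg⟩)) ?_
  refine LinearMap.mem_ker.2 (LinearMap.ext fun x => ?_)
  change y (_ - x) = 0
  rw [map_sub, sub_eq_zero]
  exact congr($hgy x)

/-- Lagrange interpolation: a polynomial of degree less than the order of `G` that takes the value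
`1` at one point of a free orbit and `0` at the others. -/
theorem exists_separating [Fintype G] [DecidableEq G] (y : V →ₗ[k] k) (hy : ∀ g : G, g ≠ 1 →
      y ∘ₗ ((g : LinearMap.GeneralLinearGroup k V) : V →ₗ[k] V) ≠ y) :
    ∃ f : SymmetricAlgebra k V, (gradingHom k V f).natDegree < Fintype.card G ∧
      ∀ g : G, symEval y (symAction G g f) = if g = 1 then 1 else 0 := by
  let y' (g : G) : V →ₗ[k] k := y ∘ₗ ((g : LinearMap.GeneralLinearGroup k V) : V →ₗ[k] V)
  have hex (g : G) : ∃ x, g ≠ 1 → y x - y' g x ≠ 0 := by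
    by_cases hg : g = 1
    · exact ⟨0, fun h => absurd hg h⟩
    · obtain ⟨x, hx⟩ := DFunLike.ne_iff.1 (hy g hg)
      exact ⟨x, fun _ => sub_ne_zero.2 hx.symm⟩
  choose x hx using hex
  -- The factor at `g` is `1` at `y` and `0` at `y' g`. There are `card G - 1` factors of degree at
  -- most one, whence the strict bound.
  refine ⟨∏ g ∈ Finset.univ.erase 1, algebraMap k _ (y (x g) - y' g (x g))⁻¹ *
    (ι k V (x g) - algebraMap k _ (y' g (x g))), ?_, fun h => ?_⟩
  · rw [map_prod]
    refine (Polynomial.natDegree_prod_le _ _).trans_lt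
      ((Finset.sum_le_card_nsmul _ _ 1 fun g _ => ?_).trans_lt ?_)
    · rw [map_mul, map_sub, AlgHom.commutes, AlgHom.commutes, gradingHom_ι,
        Polynomial.algebraMap_apply, Polynomial.algebraMap_apply]
      refine (Polynomial.natDegree_C_mul_le _ _).trans ?_
      rw [Polynomial.natDegree_sub_C]
      exact (Polynomial.natDegree_C_mul_le _ _).trans Polynomial.natDegree_X_le
    · rw [smul_eq_mul, mul_one, Finset.card_erase_of_mem (Finset.mem_univ _), Finset.card_univ]
      exact Nat.sub_lt Fintype.card_pos one_pos
  · rw [symEval_symAction, map_prod]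
    have hval (g : G) : symEval (y' h) (algebraMap k _ (y (x g) - y' g (x g))⁻¹ *
        (ι k V (x g) - algebraMap k _ (y' g (x g)))) =
        (y (x g) - y' g (x g))⁻¹ * (y' h (x g) - y' g (x g)) := by
      simp [symEval]
    change ∏ g ∈ _, symEval (y' h) _ = _
    simp only [hval]
    split_ifs with h1
    · subst h1
      refine Finset.prod_eq_one fun g hg => inv_mul_cancel₀ ?_
      exact hx g (Finset.ne_of_mem_erase hg)
    · refine Finset.prod_eq_zero (Finset.mem_erase.2 ⟨h1, Finset.mem_univ h⟩) ?_
      rw [sub_self, mul_zero]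

/-- The map of representations `W → S` attached to a linear form on `W` and an element of `S`. -/
def coeffMap [Fintype G] {W : Type*} [AddCommGroup W] [Module k W] (ρ : Representation k G W)
    (l : W →ₗ[k] k) (f : SymmetricAlgebra k V) : ρ.IntertwiningMap (linRep (symAction G)) where
  toLinearMap := ∑ g, (l ∘ₗ ρ g⁻¹).smulRight (symAction G g f)
  isIntertwining' h := by
    ext x
    simp only [LinearMap.comp_apply, LinearMap.sum_apply, LinearMap.smulRight_apply, map_sum,
      map_smul]
    refine Fintype.sum_equiv (Equiv.mulLeft h⁻¹) _ _ fun g => ?_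
    simp only [Equiv.coe_mulLeft, mul_inv_rev, inv_inv, map_mul, Module.End.mul_apply]
    congr 1
    change _ = (symAction G h * (symAction G h⁻¹ * symAction G g)) f
    rw [← map_mul, ← map_mul, mul_inv_cancel_left]

theorem coeffMap_apply [Fintype G] {W : Type*} [AddCommGroup W] [Module k W]
    (ρ : Representation k G W) (l : W →ₗ[k] k) (f : SymmetricAlgebra k V) (x : W) :
    coeffMap G ρ l f x = ∑ g, l (ρ g⁻¹ x) • symAction G g f := by
  change (∑ g, (l ∘ₗ ρ g⁻¹).smulRight (symAction G g f)) x = _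
  simp

theorem containsAllIrreducibles_of_card_le [Infinite k] [Fintype G]
    (hG : (Fintype.card G : k) ≠ 0) {q : ℕ} (hq : Fintype.card G ≤ q) :
    ContainsAllIrreducibles G q := by
  classical
  intro W _ _ ρ hρ
  obtain ⟨y, hy⟩ := exists_linearForm_trivial_stabilizer G
  obtain ⟨f, hf, hfy⟩ := exists_separating G y hy
  have : Nontrivial W := IsSimpleModule.nontrivial (MonoidAlgebra k G) ρ.asModule
  obtain ⟨x, hx⟩ := exists_ne (0 : W)
  obtain ⟨l, hl⟩ : ∃ l : Module.Dual k W, l x ≠ 0 := by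
    by_contra! h
    exact hx ((Module.forall_dual_apply_eq_zero_iff k x).1 h)
  let I := (frobPower k V q).restrictScalars k
  let φ : ρ.IntertwiningMap (frobQuotRep G q) :=
    { toLinearMap := I.mkQ ∘ₗ (coeffMap G ρ l f).toLinearMap
      isIntertwining' g := LinearMap.ext fun x =>
        congrArg I.mkQ congr($((coeffMap G ρ l f).isIntertwining' g) x) }
  refine isDirectSummandRep_of_injective hG φ
    ((Representation.IsIrreducible.injective_or_eq_zero φ).resolve_right fun h0 => hl ?_)
  have hmem : coeffMap G ρ l f x ∈ frobPower k V q :=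
    (Submodule.Quotient.mk_eq_zero I).1 congr($h0 x)
  have hzero : coeffMap G ρ l f x = 0 := by
    refine eq_zero_of_mem_frobPower hmem (lt_of_le_of_lt ?_ (hf.trans_le hq))
    rw [coeffMap_apply, map_sum]
    refine Polynomial.natDegree_sum_le_of_forall_le _ _ fun g _ => ?_
    rw [map_smul, gradingHom_symAction]
    exact (Polynomial.natDegree_smul_le _ _).trans Polynomial.natDegree_map_le
  -- At `y` only the term `g = 1` survives, leaving `l x = 0`.
  have h := congrArg (symEval y) hzero
  rw [coeffMap_apply, map_sum, map_zero] at h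
  simpa [hfy] using h

end Irreducibles

end FrobCov

end

theorem mainTheorem3 (p : ℕ) [Fact p.Prime] (k : Type*) [Field k] [IsAlgClosed k] [CharP k p]
    (V : Type*) [AddCommGroup V] [Module k V] [FiniteDimensional k V]
    (G : Subgroup (LinearMap.GeneralLinearGroup k V)) [Finite G] (hG : ¬ p ∣ Nat.card G) :
    (∃ e₀ : ℕ, ∀ e : ℕ, e₀ ≤ e →
      FrobCov.ContainsAllIrreducibles G (p ^ e) ∧ FrobCov.InvariantsFull G p e) ∧
    ((∀ g h : G, g * h = h * g) → ∀ e : ℕ, Nat.card G ≤ p ^ e →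
      FrobCov.ContainsAllIrreducibles G (p ^ e) ∧ FrobCov.InvariantsFull G p e) ∧
    (∀ e : ℕ, FrobCov.ContainsAllIrreducibles G (p ^ e) → FrobCov.InvariantsFull G p e) := by
  cases nonempty_fintype G
  rw [Nat.card_eq_fintype_card] at hG ⊢
  have hG' : (Fintype.card G : k) ≠ 0 := fun h => hG ((CharP.cast_eq_zero_iff k p _).1 h)
  have full (e : ℕ) (h : FrobCov.ContainsAllIrreducibles G (p ^ e)) :
      FrobCov.InvariantsFull G p e := h.invariantsFull p e G hG'
  have large (e : ℕ) (he : Fintype.card G ≤ p ^ e) :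
      FrobCov.ContainsAllIrreducibles G (p ^ e) ∧ FrobCov.InvariantsFull G p e :=
    have h := FrobCov.containsAllIrreducibles_of_card_le G hG' he
    ⟨h, full e h⟩
  have hp : 1 < p := (Fact.out : p.Prime).one_lt
  -- The threshold `e₀ = card G` works because `e < p ^ e`.
  refine ⟨⟨Fintype.card G, fun e he => large e ?_⟩, fun _ => large, full⟩
  exact he.trans (Nat.lt_pow_self hp).le
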